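/- Let $\mathcal L=\{\rightarrow,0\}$ with $\rightarrow$ binary and $0$ a constant, and write $\neg\varphi:=\varphi\rightarrow 0$. Let $\vdash$ be the consequence relation on the $\mathcal L$-formulas over countably infinitely many variables that is given by the axioms - (A1) $\varphi\rightarrow(\psi\rightarrow\varphi)$, - (A2) $((\varphi\rightarrow\psi)\rightarrow\psi)\rightarrow((\psi\rightarrow\varphi)\rightarrow\varphi)$, - (A3) $0\rightarrow\varphi$ and the rules - (MP) $\varphi,\ \varphi\rightarrow\psi\vdash\psi$, - (Sf) $\varphi\rightarrow\psi\vdash(\psi\rightarrow\chi)\rightarrow(\varphi\rightarrow\chi)$, - (WPf) $\varphi\rightarrow\psi,\ \psi\rightarrow\varphi\vdash(\chi\rightarrow\varphi)\rightarrow(\chi\rightarrow\psi)$, - (R1) $\varphi\rightarrow\psi\vdash(\neg\varphi\rightarrow\neg\psi)\rightarrow(\psi\rightarrow\varphi)$, - (R2) $\varphi\rightarrow\neg\psi,\ (\neg\varphi\rightarrow\psi)\rightarrow\neg\chi\vdash(\neg(\neg\varphi\rightarrow\psi)\rightarrow\chi)\rightarrow(\neg\varphi\rightarrow(\neg\psi\rightarrow\chi))$.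 For a class $\mathcal K$ of $\mathcal L$-algebras and sets $\Sigma,\Theta$ of identities, $\Sigma\models_{\mathcal K}\Theta$ means that every interpretation in a member of $\mathcal K$ satisfying all identities in $\Sigma$ satisfies all identities in $\Theta$. The class $\mathcal K$ is an *equivalent algebraic semantics* of $\vdash$, with a finite system $\delta(p)\approx\varepsilon(p)$ of defining identities in one variable and a finite system $\Delta(p,q)$ of equivalence formulas in two variables, if for all sets $\Gamma$ of formulas and all formulas $\varphi,\psi$: $$\Gamma\vdash\varphi\iff\{\delta(\gamma)\approx\varepsilon(\gamma):\gamma\in\Gamma\}\models_{\mathcal K}\delta(\varphi)\approx\varepsilon(\varphi),$$ and $\varphi\approx\psi$ and $\delta(\varphi\Delta\psi)\approx\varepsilon(\varphi\Delta\psi)$ are $\models_{\mathcal K}$-consequences of each other, where $\varphi\Delta\psi:=\Delta(\varphi,\psi)$. In an algebra $(I,\rightarrow,0)$ of type $(2,0)$ write $x':=x\rightarrow 0$ and $1:=0'$. Let $\mathcal Q$ be the quasivariety of all algebras of type $(2,0)$ satisfying 1. $x\rightarrow(y\rightarrow x)\approx1$, 2. $((x\rightarrow y)\rightarrow y)\rightarrow((y\rightarrow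 x)\rightarrow x)\approx1$, 3. $0\rightarrow x\approx1$, 4. $x\rightarrow x\approx1$, 5. $x=x\rightarrow y=1\Rightarrow y=1$, 6. $x\rightarrow y=1\Rightarrow(y\rightarrow z)\rightarrow(x\rightarrow z)=1$, 7. $x\rightarrow y=1\Rightarrow(x'\rightarrow y')\rightarrow(y\rightarrow x)=1$, 8. $x\rightarrow y=y\rightarrow x=1\Rightarrow x=y$, 9. $x\rightarrow y'=(x'\rightarrow y)\rightarrow z'=1\Rightarrow((x'\rightarrow y)'\rightarrow z)\rightarrow(x'\rightarrow(y'\rightarrow z))=1$. **Theorem.** $\mathcal Q$ is *the* equivalent algebraic semantics of $\vdash$: it is an equivalent algebraic semantics with the defining identity $p\rightarrow p\approx p$ and the equivalence formulas $\Delta(p,q)=\{p\rightarrow q,\ q\rightarrow p\}$, and a quasivariety $\mathcal K$ of algebras of type $(2,0)$ is an equivalent algebraic semantics of $\vdash$ (for some defining identities and some equivalence formulas) if and only if $\mathcal K=\mathcal Q$. Moreover, $\mathcal Q$ is exactly the class of lattice effect implication algebras, that is, of the algebras $(I,\rightarrow,0)$ of type $(2,0)$ satisfying for all $x,y,z\in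 I$: - (i) $0\rightarrow x=x\rightarrow x=x\rightarrow1=1$, - (ii) if $x\rightarrow y=y\rightarrow x=1$ then $x=y$, - (iii) if $x\rightarrow y=y\rightarrow z=1$ then $x\rightarrow z=1$, - (iv) if $x\rightarrow y=1$ then $y'\rightarrow x'=1$, - (v) $x''=x$, - (vi) $x\rightarrow((x\rightarrow y)\rightarrow y)=1$, - (vii) $y\rightarrow((x\rightarrow y)\rightarrow y)=1$, - (viii) if $x\rightarrow z=y\rightarrow z=1$ then $((x\rightarrow y)\rightarrow y)\rightarrow z=1$, - (ix) if $x\rightarrow y=1$ then $y\rightarrow x=x'\rightarrow y'$, - (x) $x\rightarrow y'=(x'\rightarrow y)\rightarrow z'=1$ if and only if $y\rightarrow z'=x\rightarrow(y'\rightarrow z)'=1$, and in this case $(x'\rightarrow y)'\rightarrow z=x'\rightarrow(y'\rightarrow z)$, - (xi) $y'\rightarrow((x\rightarrow y)\rightarrow y)'=x\rightarrow y$, - (xii) $x\rightarrow(y\rightarrow x)=1$. -/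

import Mathlib

/-!
The language has one binary connective, written `⇨` (Mathlib's notation class `HImp`, which
carries no laws), and one constant `0` (`Zero`).
-/

universe u

namespace LEA

section Language

/-- `¬ x`, also written `x'`: the abbreviation `x ⇨ 0`. -/
def neg {A : Type*} [HImp A] [Zero A] (x : A) : A := x ⇨ 0

/-- The abbreviation `1 := 0' = 0 ⇨ 0`. -/
def one (A : Type*) [HImp A] [Zero A] : A := neg (0 : A)

/-- An algebra `(A, ⇨, 0)` of type `(2, 0)`, no laws being required. -/
structure ImpAlgebra where
  /-- The underlying set. -/
  carrier : Type u
  /-- The binary operation. -/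
  [himp : HImp carrier]
  /-- The constant. -/
  [zero : Zero carrier]

attribute [instance] ImpAlgebra.himp ImpAlgebra.zero

instance : CoeSort ImpAlgebra.{u} (Type u) := ⟨ImpAlgebra.carrier⟩

/-- Formulas (equivalently, terms) in the connectives `⇨`, `0` over a set `V` of variables. -/
inductive Formula (V : Type) : Type where
  | var : V → Formula V
  | zero : Formula V
  | imp : Formula V → Formula V → Formula V

namespace Formula

variable {V W : Type}

instance : HImp (Formula V) := ⟨imp⟩

instance : Zero (Formula V) := ⟨zero⟩

/-- The value of a formula in an algebra under an interpretation of the variables. -/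
def eval {A : Type u} [HImp A] [Zero A] (v : V → A) : Formula V → A
  | var n => v n
  | zero => 0
  | imp φ ψ => eval v φ ⇨ eval v ψ

/-- Simultaneous substitution of formulas for the variables. -/
def subst (σ : V → Formula W) : Formula V → Formula W
  | var n => σ n
  | zero => 0
  | imp φ ψ => subst σ φ ⇨ subst σ ψ

end Formula

/-- The formulas of the language, over countably many propositional variables. -/
abbrev Fm : Type := Formula ℕ

/-- A formal identity `lhs ≈ rhs` over a set `V` of variables. -/
structure Identity (V : Type) where
  /-- The left-hand side. -/
  lhs : Formula V
  /-- The right-hand side. -/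
  rhs : Formula V

infix:50 " ≐ " => Identity.mk

/-- The identity `e` holds in the algebra `A` under the interpretation `v`. -/
def Identity.Holds {V : Type} (e : Identity V) (A : ImpAlgebra.{u}) (v : V → A) : Prop :=
  e.lhs.eval v = e.rhs.eval v

/-- A quasi-identity: finitely many identities imply an identity. An identity is a quasi-identity
without premises. -/
structure QuasiIdentity where
  /-- The premises. -/
  premises : List (Identity ℕ)
  /-- The conclusion. -/
  conclusion : Identity ℕ

/-- The algebra `A` satisfies the quasi-identity `q` (under all interpretations). -/
def QuasiIdentity.Valid (q : QuasiIdentity) (A : ImpAlgebra.{u}) : Prop :=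
  ∀ v : ℕ → A, (∀ e ∈ q.premises, e.Holds A v) → q.conclusion.Holds A v

/-- The class of all algebras satisfying each quasi-identity in `T`. -/
def models (T : Set QuasiIdentity) : Set ImpAlgebra.{u} :=
  {A | ∀ q ∈ T, q.Valid A}

/-- A quasivariety is a class of algebras axiomatized by a set of quasi-identities. -/
def IsQuasivariety (K : Set ImpAlgebra.{u}) : Prop :=
  ∃ T : Set QuasiIdentity, K = models T

end Language

section Semantics

/-- The semantic equational consequence relation of a class `K` of algebras. -/
def EqConsequence (K : Set ImpAlgebra.{u}) (S : Set (Identity ℕ)) (e : Identity ℕ) : Prop :=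
  ∀ A ∈ K, ∀ v : ℕ → A, (∀ s ∈ S, s.Holds A v) → e.Holds A v

/-- A system `δᵢ(p) ≈ εᵢ(p)` of identities in the single variable `p`. -/
abbrev DefiningSystem : Type := Set (Identity (Fin 1))

/-- A system `Δⱼ(p, q)` of formulas in two variables: `p` is variable `0`, `q` is variable `1`. -/
abbrev EquivalenceSystem : Type := Set (Formula (Fin 2))

/-- The set of identities `δᵢ(φ) ≈ εᵢ(φ)`. -/
def DefiningSystem.at (τ : DefiningSystem) (φ : Fm) : Set (Identity ℕ) :=
  (fun e => e.lhs.subst ![φ] ≐ e.rhs.subst ![φ]) '' τ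

/-- The set of identities `δᵢ(ψ) ≈ εᵢ(ψ)`, where `ψ` runs over `Γ`. -/
def DefiningSystem.atAll (τ : DefiningSystem) (Γ : Set Fm) : Set (Identity ℕ) :=
  ⋃ ψ ∈ Γ, τ.at ψ

/-- The set of formulas `φ Δ ψ`. -/
def EquivalenceSystem.at (D : EquivalenceSystem) (φ ψ : Fm) : Set Fm :=
  (fun d => d.subst ![φ, ψ]) '' D

/-- The class `K` is an algebraic semantics of the consequence relation `entails`, with the
finite system `τ` of defining identities. -/
structure IsAlgebraicSemanticsVia (entails : Set Fm → Fm → Prop) (K : Set ImpAlgebra.{u})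
    (τ : DefiningSystem) : Prop where
  finite_defining : τ.Finite
  entails_iff : ∀ (Γ : Set Fm) (φ : Fm),
    entails Γ φ ↔ ∀ e ∈ τ.at φ, EqConsequence K (τ.atAll Γ) e

/-- The class `K` is an equivalent algebraic semantics of the consequence relation `entails`, with
the finite system `τ` of defining identities and the finite system `D` of equivalence formulas. -/
structure IsEquivalentSemanticsVia (entails : Set Fm → Fm → Prop) (K : Set ImpAlgebra.{u})
    (τ : DefiningSystem) (D : EquivalenceSystem) : Prop
    extends IsAlgebraicSemanticsVia entails K τ where
  finite_equivalence : D.Finite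
  identity_entails : ∀ φ ψ : Fm, ∀ e ∈ τ.atAll (D.at φ ψ), EqConsequence K {φ ≐ ψ} e
  entails_identity : ∀ φ ψ : Fm, EqConsequence K (τ.atAll (D.at φ ψ)) (φ ≐ ψ)

/-- The class `K` is an equivalent algebraic semantics of the consequence relation `entails`, for
some defining identities and some equivalence formulas. -/
def IsEquivalentSemantics (entails : Set Fm → Fm → Prop) (K : Set ImpAlgebra.{u}) : Prop :=
  ∃ (τ : DefiningSystem) (D : EquivalenceSystem), IsEquivalentSemanticsVia entails K τ D

end Semantics

section Logic

/-- `Derives Γ φ`: the formula `φ` is derivable from the set `Γ` of formulas by the axioms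
(A1)-(A3) and the rules (MP), (Sf), (WPf), (R1), (R2), all of them schematic. -/
inductive Derives (Γ : Set Fm) : Fm → Prop where
  | hyp {φ : Fm} : φ ∈ Γ → Derives Γ φ
  | A1 (φ ψ : Fm) : Derives Γ (φ ⇨ (ψ ⇨ φ))
  | A2 (φ ψ : Fm) : Derives Γ (((φ ⇨ ψ) ⇨ ψ) ⇨ ((ψ ⇨ φ) ⇨ φ))
  | A3 (φ : Fm) : Derives Γ (0 ⇨ φ)
  | MP {φ ψ : Fm} : Derives Γ φ → Derives Γ (φ ⇨ ψ) → Derives Γ ψ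
  | Sf {φ ψ : Fm} (χ : Fm) : Derives Γ (φ ⇨ ψ) → Derives Γ ((ψ ⇨ χ) ⇨ (φ ⇨ χ))
  | WPf {φ ψ : Fm} (χ : Fm) : Derives Γ (φ ⇨ ψ) → Derives Γ (ψ ⇨ φ) →
      Derives Γ ((χ ⇨ φ) ⇨ (χ ⇨ ψ))
  | R1 {φ ψ : Fm} : Derives Γ (φ ⇨ ψ) → Derives Γ ((neg φ ⇨ neg ψ) ⇨ (ψ ⇨ φ))
  | R2 {φ ψ χ : Fm} : Derives Γ (φ ⇨ neg ψ) → Derives Γ ((neg φ ⇨ ψ) ⇨ neg χ) →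
      Derives Γ ((neg (neg φ ⇨ ψ) ⇨ χ) ⇨ (neg φ ⇨ (neg ψ ⇨ χ)))

/-- The single defining identity `p ⇨ p ≈ p`. -/
def defining : DefiningSystem :=
  {(.var 0 ⇨ .var 0) ≐ .var 0}

/-- The two equivalence formulas `p ⇨ q` and `q ⇨ p`. -/
def equivalence : EquivalenceSystem :=
  {.var 0 ⇨ .var 1, .var 1 ⇨ .var 0}

end Logic

section Axioms

/-- The variable `x`. -/
def x : Fm := .var 0

/-- The variable `y`. -/
def y : Fm := .var 1

/-- The variable `z`. -/
def z : Fm := .var 2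

/-- The nine identities and quasi-identities. -/
def laws : Set QuasiIdentity :=
  { ⟨[], x ⇨ (y ⇨ x) ≐ one Fm⟩,
    ⟨[], ((x ⇨ y) ⇨ y) ⇨ ((y ⇨ x) ⇨ x) ≐ one Fm⟩,
    ⟨[], 0 ⇨ x ≐ one Fm⟩,
    ⟨[], x ⇨ x ≐ one Fm⟩,
    ⟨[x ≐ one Fm, x ⇨ y ≐ one Fm], y ≐ one Fm⟩,
    ⟨[x ⇨ y ≐ one Fm], (y ⇨ z) ⇨ (x ⇨ z) ≐ one Fm⟩,
    ⟨[x ⇨ y ≐ one Fm], (neg x ⇨ neg y) ⇨ (y ⇨ x) ≐ one Fm⟩,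
    ⟨[x ⇨ y ≐ one Fm, y ⇨ x ≐ one Fm], x ≐ y⟩,
    ⟨[x ⇨ neg y ≐ one Fm, (neg x ⇨ y) ⇨ neg z ≐ one Fm],
      (neg (neg x ⇨ y) ⇨ z) ⇨ (neg x ⇨ (neg y ⇨ z)) ≐ one Fm⟩ }

end Axioms

/-- The algebra `(I, ⇨, 0)` is a lattice effect implication algebra. -/
structure IsLatticeEffectImplicationAlgebra (I : ImpAlgebra.{u}) : Prop where
  zero_imp : ∀ x : I, 0 ⇨ x = one I
  imp_self : ∀ x : I, x ⇨ x = one I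
  imp_one : ∀ x : I, x ⇨ one I = one I
  antisymm : ∀ x y : I, x ⇨ y = one I → y ⇨ x = one I → x = y
  trans : ∀ x y z : I, x ⇨ y = one I → y ⇨ z = one I → x ⇨ z = one I
  neg_antitone : ∀ x y : I, x ⇨ y = one I → neg y ⇨ neg x = one I
  neg_neg : ∀ x : I, neg (neg x) = x
  le_sup_left : ∀ x y : I, x ⇨ ((x ⇨ y) ⇨ y) = one I
  le_sup_right : ∀ x y : I, y ⇨ ((x ⇨ y) ⇨ y) = one I
  sup_le : ∀ x y z : I, x ⇨ z = one I → y ⇨ z = one I → ((x ⇨ y) ⇨ y) ⇨ z = one I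
  contraposition : ∀ x y : I, x ⇨ y = one I → y ⇨ x = neg x ⇨ neg y
  assoc_defined : ∀ x y z : I,
    (x ⇨ neg y = one I ∧ (neg x ⇨ y) ⇨ neg z = one I) ↔
      (y ⇨ neg z = one I ∧ x ⇨ neg (neg y ⇨ z) = one I)
  assoc : ∀ x y z : I, x ⇨ neg y = one I → (neg x ⇨ y) ⇨ neg z = one I →
    neg (neg x ⇨ y) ⇨ z = neg x ⇨ (neg y ⇨ z)
  neg_imp_neg_sup : ∀ x y : I, neg y ⇨ neg ((x ⇨ y) ⇨ y) = x ⇨ y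
  imp_imp : ∀ x y : I, x ⇨ (y ⇨ x) = one I

/-- The class of lattice effect implication algebras. -/
def latticeEffectImplicationAlgebras : Set ImpAlgebra.{u} :=
  {I | IsLatticeEffectImplicationAlgebra I}

end LEA

-- Read `x ⇨ y = 1` as an order `x ≤ y`, `(x ⇨ y) ⇨ y` as a join, and `neg x ⇨ y` as a partial sum
-- `x ⊕ y`, defined when `x ≤ neg y`.
--
-- The nine laws make the join commutative, whence `1 ⇨ x = x` and `neg (neg x) = x`; commutativity
-- and associativity of `⊕` follow. Conversely, in a lattice effect implication algebra the only law
-- needing real work is suffixing, which follows from associativity of `⊕` through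
-- `prefixing_of_le`.
--
-- The calculus is complete for these algebras by the Lindenbaum construction (`derives_iff`). Since
-- `x ⇨ x = 1`, the defining identity says exactly that a formula takes the value 1, and
-- antisymmetry makes the two implications express equality.
--
-- For uniqueness, the equivalence formulas of any two semantics of one logic entail each other
-- (`entails_equivalence`). Equational consequence in each class is therefore the same relation, and
-- it determines a quasivariety.

universe w

namespace LEA

/-! ### The nine laws and lattice effect implication algebras -/

section LawsInAlgebras

/-- The nine laws, read as statements about the elements of an algebra. -/
structure SatisfiesLaws (I : ImpAlgebra.{w}) : Prop where
  imp_imp : ∀ x y : I, x ⇨ (y ⇨ x) = one I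
  sup_comm_le : ∀ x y : I, ((x ⇨ y) ⇨ y) ⇨ ((y ⇨ x) ⇨ x) = one I
  zero_imp : ∀ x : I, 0 ⇨ x = one I
  imp_self : ∀ x : I, x ⇨ x = one I
  mp : ∀ x y : I, x = one I → x ⇨ y = one I → y = one I
  suffixing : ∀ x y z : I, x ⇨ y = one I → (y ⇨ z) ⇨ (x ⇨ z) = one I
  contraposition_le : ∀ x y : I, x ⇨ y = one I → (neg x ⇨ neg y) ⇨ (y ⇨ x) = one I
  antisymm : ∀ x y : I, x ⇨ y = one I → y ⇨ x = one I → x = y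
  assoc_le : ∀ x y z : I, x ⇨ neg y = one I → (neg x ⇨ y) ⇨ neg z = one I →
    (neg (neg x ⇨ y) ⇨ z) ⇨ (neg x ⇨ (neg y ⇨ z)) = one I

theorem eval_one {A : Type w} [HImp A] [Zero A] (v : ℕ → A) :
    Formula.eval v (one Fm) = one A := rfl

theorem eval_neg {A : Type w} [HImp A] [Zero A] (v : ℕ → A) (φ : Fm) :
    Formula.eval v (neg φ) = neg (Formula.eval v φ) := rfl

theorem eval_imp {A : Type w} [HImp A] [Zero A] (v : ℕ → A) (φ ψ : Fm) :
    Formula.eval v (φ ⇨ ψ) = (Formula.eval v φ ⇨ Formula.eval v ψ) := rfl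

theorem eval_zero {A : Type w} [HImp A] [Zero A] (v : ℕ → A) :
    Formula.eval v (0 : Fm) = 0 := rfl

/-- The interpretation of the first three variables by `a`, `b`, `c`. -/
def valuation {A : Type w} (a b c : A) : ℕ → A
  | 0 => a
  | 1 => b
  | _ => c

theorem mem_models_laws_iff (I : ImpAlgebra.{w}) : I ∈ models laws ↔ SatisfiesLaws I := by
  simp only [models, laws, Set.mem_ofPred_eq, Set.mem_insert_iff, Set.mem_singleton_iff,
    forall_eq_or_imp, forall_eq, QuasiIdentity.Valid, Identity.Holds, List.mem_cons,
    List.not_mem_nil, or_false, false_imp_iff, implies_true, forall_const,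
    eval_one, eval_neg, eval_imp, eval_zero]
  constructor
  · rintro ⟨h1, h2, h3, h4, h5, h6, h7, h8, h9⟩
    exact
      { imp_imp := fun a b => h1 (valuation a b 0)
        sup_comm_le := fun a b => h2 (valuation a b 0)
        zero_imp := fun a => h3 (valuation a 0 0)
        imp_self := fun a => h4 (valuation a 0 0)
        mp := fun a b p q => h5 (valuation a b 0) ⟨p, q⟩
        suffixing := fun a b c p => h6 (valuation a b c) p
        contraposition_le := fun a b p => h7 (valuation a b 0) p
        antisymm := fun a b p q => h8 (valuation a b 0) ⟨p, q⟩
        assoc_le := fun a b c p q => h9 (valuation a b c) ⟨p, q⟩ }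
  · intro h
    exact ⟨fun _ => h.imp_imp _ _, fun _ => h.sup_comm_le _ _, fun _ => h.zero_imp _,
      fun _ => h.imp_self _, fun _ p => h.mp _ _ p.1 p.2, fun _ p => h.suffixing _ _ _ p,
      fun _ p => h.contraposition_le _ _ p, fun _ p => h.antisymm _ _ p.1 p.2,
      fun _ p => h.assoc_le _ _ _ p.1 p.2⟩

namespace SatisfiesLaws

variable {I : ImpAlgebra.{w}} (h : SatisfiesLaws I)
include h

theorem one_imp_eq_one {x : I} (hx : one I ⇨ x = one I) : x = one I := h.mp _ _ rfl hx

theorem imp_one (x : I) : x ⇨ one I = one I := h.one_imp_eq_one (h.imp_imp _ _)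

theorem sup_comm (x y : I) : (x ⇨ y) ⇨ y = (y ⇨ x) ⇨ x :=
  h.antisymm _ _ (h.sup_comm_le _ _) (h.sup_comm_le _ _)

/-- By commutativity of the join, `(1 ⇨ x) ⇨ x = (x ⇨ 1) ⇨ 1 = 1`. -/
theorem one_imp (x : I) : one I ⇨ x = x :=
  h.antisymm _ _ (by rw [h.sup_comm, h.imp_one]) (h.imp_imp _ _)

theorem trans {x y z : I} (hxy : x ⇨ y = one I) (hyz : y ⇨ z = one I) : x ⇨ z = one I := by
  have := h.suffixing x y z hxy
  rw [hyz] at this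
  exact h.one_imp_eq_one this

theorem neg_antitone {x y : I} (hxy : x ⇨ y = one I) : neg y ⇨ neg x = one I :=
  h.suffixing x y 0 hxy

theorem neg_neg (x : I) : neg (neg x) = x := by
  change (x ⇨ 0) ⇨ 0 = x
  rw [h.sup_comm, h.zero_imp, h.one_imp]

theorem le_sup_left (x y : I) : x ⇨ ((x ⇨ y) ⇨ y) = one I := by
  rw [h.sup_comm]
  exact h.imp_imp _ _

theorem sup_eq_right {x y : I} (hxy : x ⇨ y = one I) : (x ⇨ y) ⇨ y = y := by
  rw [hxy, h.one_imp]

theorem sup_eq_left {x y : I} (hxy : x ⇨ y = one I) : (y ⇨ x) ⇨ x = y := by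
  rw [h.sup_comm, h.sup_eq_right hxy]

/-- Suffixing `x ≤ z` by `y` twice gives `(x ⇨ y) ⇨ y ≤ (z ⇨ y) ⇨ y`, and the right side is `z`
because `y ≤ z`. -/
theorem sup_le {x y z : I} (hxz : x ⇨ z = one I) (hyz : y ⇨ z = one I) :
    ((x ⇨ y) ⇨ y) ⇨ z = one I := by
  have := h.suffixing _ _ y (h.suffixing x z y hxz)
  rwa [h.sup_eq_left hyz] at this

theorem contraposition {x y : I} (hxy : x ⇨ y = one I) : y ⇨ x = neg x ⇨ neg y := by
  refine h.antisymm _ _ ?_ (h.contraposition_le _ _ hxy)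
  have := h.contraposition_le _ _ (h.neg_antitone hxy)
  rwa [h.neg_neg, h.neg_neg] at this

theorem le_neg_comm {x y : I} (hxy : x ⇨ neg y = one I) : y ⇨ neg x = one I := by
  have := h.neg_antitone hxy
  rwa [h.neg_neg] at this

/-- Commutativity of the partial sum `neg x ⇨ y`. -/
theorem add_comm {x y : I} (hxy : x ⇨ neg y = one I) : neg x ⇨ y = neg y ⇨ x := by
  rw [h.contraposition hxy, h.neg_neg]

theorem assoc_defined_of {x y z : I} (hxy : x ⇨ neg y = one I)
    (hxyz : (neg x ⇨ y) ⇨ neg z = one I) :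
    y ⇨ neg z = one I ∧ x ⇨ neg (neg y ⇨ z) = one I := by
  have hyz : y ⇨ neg z = one I := h.trans (h.imp_imp y (neg x)) hxyz
  -- Suffixing `x ⊕ y ≤ neg z` by `y` gives `neg z ⇨ y ≤ (neg x ⇨ y) ⇨ y`; the left side is `y ⊕ z`,
  -- the right side is `neg x`.
  refine ⟨hyz, h.le_neg_comm ?_⟩
  have := h.suffixing _ _ y hxyz
  rwa [h.sup_eq_left (h.le_neg_comm hxy), ← h.add_comm hyz] at this

theorem assoc_defined (x y z : I) :
    (x ⇨ neg y = one I ∧ (neg x ⇨ y) ⇨ neg z = one I) ↔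
      (y ⇨ neg z = one I ∧ x ⇨ neg (neg y ⇨ z) = one I) := by
  refine ⟨fun hl => h.assoc_defined_of hl.1 hl.2, fun ⟨hyz, hx⟩ => ?_⟩
  -- Reversing the order of the summands turns the converse into the direction already proved, for
  -- `z, y, x`.
  rw [h.add_comm hyz] at hx
  obtain ⟨hyx, hz⟩ := h.assoc_defined_of (h.le_neg_comm hyz) (h.le_neg_comm hx)
  rw [h.add_comm hyx] at hz
  exact ⟨h.le_neg_comm hyx, h.le_neg_comm hz⟩

theorem assoc {x y z : I} (hxy : x ⇨ neg y = one I) (hxyz : (neg x ⇨ y) ⇨ neg z = one I) :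
    neg (neg x ⇨ y) ⇨ z = neg x ⇨ (neg y ⇨ z) := by
  obtain ⟨hyz, hx⟩ := h.assoc_defined_of hxy hxyz
  refine h.antisymm _ _ (h.assoc_le _ _ _ hxy hxyz) ?_
  -- The reverse inequality becomes `(z ⊕ y) ⊕ x ≤ z ⊕ (y ⊕ x)`, again an instance of the law.
  rw [h.add_comm hx, h.add_comm hyz, h.add_comm hxyz, h.add_comm hxy]
  rw [h.add_comm hyz] at hx
  exact h.assoc_le _ _ _ (h.le_neg_comm hyz) (h.le_neg_comm hx)

theorem sup_imp (x y : I) : ((x ⇨ y) ⇨ y) ⇨ y = x ⇨ y :=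
  h.antisymm _ _ (h.suffixing _ _ _ (h.le_sup_left x y)) (h.le_sup_left _ _)

theorem isLatticeEffectImplicationAlgebra : IsLatticeEffectImplicationAlgebra I where
  zero_imp := h.zero_imp
  imp_self := h.imp_self
  imp_one := h.imp_one
  antisymm := h.antisymm
  trans _ _ _ := h.trans
  neg_antitone _ _ := h.neg_antitone
  neg_neg := h.neg_neg
  le_sup_left := h.le_sup_left
  le_sup_right _ _ := h.imp_imp _ _
  sup_le _ _ _ := h.sup_le
  contraposition _ _ := h.contraposition
  assoc_defined := h.assoc_defined
  assoc _ _ _ := h.assoc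
  neg_imp_neg_sup x y := by
    rw [← h.contraposition (h.imp_imp y (x ⇨ y)), h.sup_imp]
  imp_imp := h.imp_imp

end SatisfiesLaws

/-! ### From lattice effect implication algebras back to the nine laws -/

namespace IsLatticeEffectImplicationAlgebra

variable {I : ImpAlgebra.{w}} (h : IsLatticeEffectImplicationAlgebra I)
include h

theorem sup_eq_left {x y : I} (hyx : y ⇨ x = one I) : (x ⇨ y) ⇨ y = x :=
  h.antisymm _ _ (h.sup_le _ _ _ (h.imp_self x) hyx) (h.le_sup_left x y)

/-- An element below `y` completes to `y` by a partial sum. -/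
theorem add_sub {x y : I} (hxy : x ⇨ y = one I) : neg x ⇨ neg (y ⇨ x) = y := by
  rw [← h.contraposition x (y ⇨ x) (h.imp_imp x y), h.sup_eq_left hxy]

theorem le_add {x y : I} (hxy : x ⇨ neg y = one I) : x ⇨ (neg x ⇨ y) = one I := by
  have := h.imp_imp x (neg y)
  rwa [h.contraposition _ _ hxy, h.neg_neg] at this

/-- The operation `c ⇨ ·` is monotone below `c`. -/
theorem prefixing_of_le {a b c : I} (hab : a ⇨ b = one I) (hbc : b ⇨ c = one I) :
    (c ⇨ a) ⇨ (c ⇨ b) = one I := by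
  -- Put `d = neg (b ⇨ a)`, so that `b = a ⊕ d`. Then `c ⇨ b = neg c ⊕ (a ⊕ d) = (neg c ⊕ a) ⊕ d ≥
  -- neg c ⊕ a = c ⇨ a`.
  have hd : a ⇨ neg (neg (b ⇨ a)) = one I := by rw [h.neg_neg]; exact h.imp_imp _ _
  have hc : neg c ⇨ neg (neg a ⇨ neg (b ⇨ a)) = one I := by
    rw [h.add_sub hab]; exact h.neg_antitone _ _ hbc
  obtain ⟨h1, h2⟩ := (h.assoc_defined (neg c) a (neg (b ⇨ a))).2 ⟨hd, hc⟩
  have h3 := h.assoc _ _ _ h1 h2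
  have h4 := h.le_add h2
  rwa [h3, h.add_sub hab, h.neg_neg] at h4

theorem suffixing {x y : I} (z : I) (hxy : x ⇨ y = one I) : (y ⇨ z) ⇨ (x ⇨ z) = one I := by
  -- Both implications now start from `neg z`, which lies above the negated joins, so antitonicity
  -- in the first argument becomes monotonicity in the second.
  rw [← h.neg_imp_neg_sup y z, ← h.neg_imp_neg_sup x z]
  refine h.prefixing_of_le (h.neg_antitone _ _ ?_) (h.neg_antitone _ _ (h.le_sup_right _ _))
  exact h.sup_le _ _ _ (h.trans _ _ _ hxy (h.le_sup_left _ _)) (h.le_sup_right _ _)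

theorem satisfiesLaws : SatisfiesLaws I where
  imp_imp := h.imp_imp
  sup_comm_le _ _ := h.sup_le _ _ _ (h.le_sup_right _ _) (h.le_sup_left _ _)
  zero_imp := h.zero_imp
  imp_self := h.imp_self
  mp x y hx hxy := by
    subst hx
    exact h.antisymm _ _ (h.imp_one y) hxy
  suffixing _ _ z := h.suffixing z
  contraposition_le x y hxy := by
    rw [h.contraposition x y hxy]
    exact h.imp_self _
  antisymm := h.antisymm
  assoc_le x y z hxy hxyz := by
    rw [h.assoc x y z hxy hxyz]
    exact h.imp_self _

end IsLatticeEffectImplicationAlgebra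

theorem models_laws_eq_latticeEffectImplicationAlgebras :
    models.{w} laws = latticeEffectImplicationAlgebras.{w} := by
  ext I
  rw [mem_models_laws_iff]
  exact ⟨fun h => h.isLatticeEffectImplicationAlgebra, fun h => h.satisfiesLaws⟩

end LawsInAlgebras

/-! ### Soundness and completeness via the Lindenbaum algebra -/

section Completeness

theorem Derives.sound {I : ImpAlgebra.{w}} (h : SatisfiesLaws I) (v : ℕ → I) {Γ : Set Fm}
    (hΓ : ∀ γ ∈ Γ, γ.eval v = one I) {φ : Fm} (d : Derives Γ φ) : φ.eval v = one I := by
  induction d with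
  | hyp hφ => exact hΓ _ hφ
  | A1 φ ψ => exact h.imp_imp _ _
  | A2 φ ψ => exact h.sup_comm_le _ _
  | A3 φ => exact h.zero_imp _
  | MP _ _ h1 h2 => exact h.mp _ _ h1 h2
  | Sf χ _ h1 => exact h.suffixing _ _ _ h1
  | WPf χ _ _ h1 h2 =>
    rw [eval_imp, eval_imp, eval_imp, h.antisymm _ _ h1 h2]
    exact h.imp_self _
  | R1 _ h1 => exact h.contraposition_le _ _ h1
  | R2 _ _ h1 h2 => exact h.assoc_le _ _ _ h1 h2

namespace Derives

variable {Γ : Set Fm} {φ ψ χ : Fm}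

theorem imp_of_right (ψ : Fm) (h : Derives Γ φ) : Derives Γ (ψ ⇨ φ) := MP h (A1 φ ψ)

theorem one : Derives Γ (one Fm) := A3 0

theorem trans (h1 : Derives Γ (φ ⇨ ψ)) (h2 : Derives Γ (ψ ⇨ χ)) : Derives Γ (φ ⇨ χ) :=
  MP h2 (Sf χ h1)

theorem refl (φ : Fm) : Derives Γ (φ ⇨ φ) :=
  -- Compose `φ ⇨ (1 ⇨ φ)` with `(1 ⇨ φ) ⇨ φ`; the latter comes from (A2), as `(φ ⇨ 1) ⇨ 1` is
  -- derivable.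
  (A1 φ (LEA.one Fm)).trans (MP (one.imp_of_right _) (A2 φ (LEA.one Fm)))

theorem imp_congr {φ' ψ' : Fm} (hφ : Derives Γ (φ' ⇨ φ)) (hψ : Derives Γ (ψ ⇨ ψ'))
    (hψ' : Derives Γ (ψ' ⇨ ψ)) : Derives Γ ((φ ⇨ ψ) ⇨ (φ' ⇨ ψ')) :=
  (Sf ψ hφ).trans (WPf φ' hψ hψ')

end Derives

/-- Two formulas are equivalent modulo `Γ` if each derivably implies the other. -/
def lindenbaumSetoid (Γ : Set Fm) : Setoid Fm where
  r φ ψ := Derives Γ (φ ⇨ ψ) ∧ Derives Γ (ψ ⇨ φ)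
  iseqv := ⟨fun φ => ⟨.refl φ, .refl φ⟩, fun h => ⟨h.2, h.1⟩,
    fun h k => ⟨h.1.trans k.1, k.2.trans h.2⟩⟩

/-- The Lindenbaum algebra of the theory generated by `Γ`. -/
def lindenbaum (Γ : Set Fm) : ImpAlgebra.{w} where
  carrier := ULift.{w} (Quotient (lindenbaumSetoid Γ))
  himp := ⟨fun a b => ⟨Quotient.map₂ (· ⇨ ·)
    (fun φ φ' (h : Derives Γ (φ ⇨ φ') ∧ Derives Γ (φ' ⇨ φ))
      ψ ψ' (k : Derives Γ (ψ ⇨ ψ') ∧ Derives Γ (ψ' ⇨ ψ)) =>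
      ⟨.imp_congr h.2 k.1 k.2, .imp_congr h.1 k.2 k.1⟩) a.down b.down⟩⟩
  zero := ⟨⟨Quotient.mk _ 0⟩⟩

namespace lindenbaum

variable (Γ : Set Fm)

/-- The class of a formula. -/
def mk (φ : Fm) : lindenbaum.{w} Γ := ULift.up (Quotient.mk (lindenbaumSetoid Γ) φ)

theorem mk_surjective : Function.Surjective (mk.{w} Γ) := by
  rintro ⟨a⟩
  obtain ⟨φ, rfl⟩ := Quotient.exists_rep a
  exact ⟨φ, rfl⟩

theorem mk_imp (φ ψ : Fm) : mk.{w} Γ φ ⇨ mk Γ ψ = mk Γ (φ ⇨ ψ) := rfl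

theorem mk_neg (φ : Fm) : neg (mk.{w} Γ φ) = mk Γ (neg φ) := rfl

theorem mk_zero : (0 : lindenbaum.{w} Γ) = mk Γ 0 := rfl

theorem mk_eq_mk {φ ψ : Fm} :
    mk.{w} Γ φ = mk Γ ψ ↔ Derives Γ (φ ⇨ ψ) ∧ Derives Γ (ψ ⇨ φ) :=
  ULift.up_inj.trans Quotient.eq

theorem mk_eq_one {φ : Fm} : mk.{w} Γ φ = one _ ↔ Derives Γ φ :=
  (mk_eq_mk Γ (ψ := one Fm)).trans
    ⟨fun h => Derives.one.MP h.2, fun h => ⟨Derives.one.imp_of_right _, h.imp_of_right _⟩⟩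

theorem satisfiesLaws : SatisfiesLaws (lindenbaum.{w} Γ) := by
  constructor <;> simp only [(mk_surjective Γ).forall, mk_zero, mk_neg, mk_imp, mk_eq_one]
  · exact .A1
  · exact .A2
  · exact .A3
  · exact .refl
  · exact fun _ _ => .MP
  · exact fun _ _ χ => .Sf χ
  · exact fun _ _ => .R1
  · exact fun _ _ h k => (mk_eq_mk Γ).2 ⟨h, k⟩
  · exact fun _ _ _ => .R2

theorem eval_mk (φ : Fm) : φ.eval (fun n => mk.{w} Γ (.var n)) = mk Γ φ := by
  induction φ with
  | var n => rfl
  | zero => rfl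
  | imp φ ψ ihφ ihψ =>
    rw [Formula.eval, ihφ, ihψ]
    rfl

end lindenbaum

theorem derives_iff (Γ : Set Fm) (φ : Fm) : Derives Γ φ ↔
    ∀ I : ImpAlgebra.{w}, SatisfiesLaws I → ∀ v : ℕ → I,
      (∀ γ ∈ Γ, γ.eval v = one I) → φ.eval v = one I := by
  refine ⟨fun d I h v hΓ => d.sound h v hΓ, fun h => ?_⟩
  rw [← lindenbaum.mk_eq_one.{w}, ← lindenbaum.eval_mk]
  refine h _ (lindenbaum.satisfiesLaws Γ) _ fun γ hγ => ?_
  rw [lindenbaum.eval_mk, lindenbaum.mk_eq_one]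
  exact .hyp hγ

end Completeness

/-! ### The defining identity and the equivalence formulas -/

section Semantics

theorem DefiningSystem.forall_mem_atAll {τ : DefiningSystem} {Γ : Set Fm}
    {p : Identity ℕ → Prop} : (∀ e ∈ τ.atAll Γ, p e) ↔ ∀ γ ∈ Γ, ∀ e ∈ τ.at γ, p e := by
  simp only [DefiningSystem.atAll, Set.mem_iUnion]
  grind

theorem forall_mem_defining_at {φ : Fm} {p : Identity ℕ → Prop} :
    (∀ e ∈ defining.at φ, p e) ↔ p ((φ ⇨ φ) ≐ φ) := by
  simp only [DefiningSystem.at, defining, Set.image_singleton, Set.mem_singleton_iff, forall_eq]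
  rfl

theorem forall_mem_equivalence_at {φ ψ : Fm} {p : Fm → Prop} :
    (∀ χ ∈ equivalence.at φ ψ, p χ) ↔ p (φ ⇨ ψ) ∧ p (ψ ⇨ φ) := by
  simp only [EquivalenceSystem.at, equivalence, Set.image_pair, Set.mem_insert_iff,
    Set.mem_singleton_iff, forall_eq_or_imp, forall_eq]
  rfl

theorem SatisfiesLaws.defining_holds_iff {I : ImpAlgebra.{w}} (h : SatisfiesLaws I) (v : ℕ → I)
    (φ : Fm) : ((φ ⇨ φ) ≐ φ).Holds I v ↔ φ.eval v = one I := by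
  rw [Identity.Holds, eval_imp, h.imp_self, eq_comm]

theorem isEquivalentSemanticsVia_models_laws :
    IsEquivalentSemanticsVia Derives (models.{w} laws) defining equivalence where
  finite_defining := Set.finite_singleton _
  finite_equivalence := (Set.finite_singleton _).insert _
  entails_iff Γ φ := by
    rw [derives_iff.{w}, forall_mem_defining_at]
    refine forall_congr' fun I => ?_
    rw [mem_models_laws_iff]
    refine forall_congr' fun h => forall_congr' fun v => ?_
    simp only [DefiningSystem.forall_mem_atAll, forall_mem_defining_at, h.defining_holds_iff]
  identity_entails φ ψ := by
    simp only [DefiningSystem.forall_mem_atAll, forall_mem_defining_at, forall_mem_equivalence_at]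
    constructor <;>
    · intro I hI v hv
      rw [mem_models_laws_iff] at hI
      have hv : φ.eval v = ψ.eval v := hv _ rfl
      rw [hI.defining_holds_iff, eval_imp, hv, hI.imp_self]
  entails_identity φ ψ := by
    intro I hI v hv
    rw [mem_models_laws_iff] at hI
    simp only [DefiningSystem.forall_mem_atAll, forall_mem_defining_at, forall_mem_equivalence_at,
      hI.defining_holds_iff] at hv
    exact hI.antisymm _ _ hv.1 hv.2

end Semantics

/-! ### Uniqueness of the equivalent quasivariety semantics -/

section Uniqueness

theorem eval_subst {V W : Type} {A : Type w} [HImp A] [Zero A] (v : W → A) (σ : V → Formula W)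
    (φ : Formula V) : (φ.subst σ).eval v = φ.eval (fun n => (σ n).eval v) := by
  induction φ with
  | var n => rfl
  | zero => rfl
  | imp φ ψ ihφ ihψ =>
    change (φ.subst σ).eval v ⇨ (ψ.subst σ).eval v = _
    rw [ihφ, ihψ]
    rfl

theorem eval_subst_pair_congr {A : Type w} [HImp A] [Zero A] (v : ℕ → A) {φ ψ φ' ψ' : Fm}
    (hφ : φ.eval v = φ'.eval v) (hψ : ψ.eval v = ψ'.eval v) (d : Formula (Fin 2)) :
    (d.subst ![φ, ψ]).eval v = (d.subst ![φ', ψ']).eval v := by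
  rw [eval_subst, eval_subst]
  congr 1
  ext i
  fin_cases i
  · exact hφ
  · exact hψ

theorem DefiningSystem.holds_at_congr {I : ImpAlgebra.{w}} (v : ℕ → I) {φ ψ : Fm}
    (h : φ.eval v = ψ.eval v) {τ : DefiningSystem} (hφ : ∀ e ∈ τ.at φ, e.Holds I v) :
    ∀ e ∈ τ.at ψ, e.Holds I v := by
  rintro _ ⟨e, he, rfl⟩
  have := hφ _ ⟨e, he, rfl⟩
  have hσ : (fun n => ((![φ] : Fin 1 → Fm) n).eval v) =
      fun n => ((![ψ] : Fin 1 → Fm) n).eval v := by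
    ext i
    fin_cases i
    exact h
  simp only [Identity.Holds, eval_subst] at this ⊢
  rwa [← hσ]

variable {entails : Set Fm → Fm → Prop} {K K₁ K₂ : Set ImpAlgebra.{w}}
  {τ τ₁ τ₂ : DefiningSystem} {D D₁ D₂ : EquivalenceSystem}

theorem IsAlgebraicSemanticsVia.sound (h : IsAlgebraicSemanticsVia entails K τ)
    {I : ImpAlgebra.{w}} (hI : I ∈ K) (v : ℕ → I) {Γ : Set Fm} {φ : Fm} (d : entails Γ φ)
    (hΓ : ∀ γ ∈ Γ, ∀ e ∈ τ.at γ, e.Holds I v) : ∀ e ∈ τ.at φ, e.Holds I v :=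
  fun e he => (h.entails_iff Γ φ).1 d e he I hI v (DefiningSystem.forall_mem_atAll.2 hΓ)

namespace IsEquivalentSemanticsVia

theorem entails_refl (h : IsEquivalentSemanticsVia entails K τ D) {φ χ : Fm}
    (hχ : χ ∈ D.at φ φ) : entails ∅ χ := by
  refine (h.entails_iff _ _).2 fun e he I hI v _ => ?_
  refine h.identity_entails φ φ e ?_ I hI v ?_
  · exact Set.mem_biUnion hχ he
  · rintro _ rfl
    rfl

theorem holds_iff (h : IsEquivalentSemanticsVia entails K τ D) {I : ImpAlgebra.{w}} (hI : I ∈ K)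
    (v : ℕ → I) (e : Identity ℕ) :
    e.Holds I v ↔ ∀ χ ∈ D.at e.lhs e.rhs, ∀ e' ∈ τ.at χ, e'.Holds I v := by
  rw [← DefiningSystem.forall_mem_atAll]
  refine ⟨fun he e' he' => h.identity_entails _ _ e' he' I hI v ?_,
    h.entails_identity _ _ I hI v⟩
  rintro _ rfl
  exact he

/-- The equivalence formulas of one semantics are entailed by those of another. -/
theorem entails_equivalence (h₁ : IsEquivalentSemanticsVia entails K₁ τ₁ D₁)
    (h₂ : IsEquivalentSemanticsVia entails K₂ τ₂ D₂) {φ ψ χ : Fm} (hχ : χ ∈ D₁.at φ ψ) :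
    entails (D₂.at φ ψ) χ := by
  refine (h₂.entails_iff _ _).2 fun e he I hI v hv => ?_
  have heq : φ.eval v = ψ.eval v := h₂.entails_identity φ ψ I hI v hv
  obtain ⟨d, hd, rfl⟩ := hχ
  -- `d(φ, φ)` is a theorem of the logic, and `d(φ, ψ)` has the same value because `φ` and `ψ` do.
  have hrefl : entails ∅ (d.subst ![φ, φ]) := h₁.entails_refl ⟨d, hd, rfl⟩
  exact DefiningSystem.holds_at_congr v (eval_subst_pair_congr v rfl heq d)
    (h₂.sound hI v hrefl (by simp)) e he

/-- Translated by `D₁`, the consequence over `K₁` becomes an entailment of the logic. To read it in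
`K₂`, exchange `D₂` for `D₁` on the premises and `D₁` for `D₂` on the conclusion. -/
theorem eqConsequence_of (h₁ : IsEquivalentSemanticsVia entails K₁ τ₁ D₁)
    (h₂ : IsEquivalentSemanticsVia entails K₂ τ₂ D₂) {S : Set (Identity ℕ)} {e : Identity ℕ}
    (h : EqConsequence K₁ S e) : EqConsequence K₂ S e := by
  intro I hI v hv
  have hentails : ∀ χ ∈ D₁.at e.lhs e.rhs, entails (⋃ s ∈ S, D₁.at s.lhs s.rhs) χ := by
    intro χ hχ
    refine (h₁.entails_iff _ _).2 fun e' he' J hJ u hu => ?_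
    rw [DefiningSystem.forall_mem_atAll] at hu
    refine (h₁.holds_iff hJ u e).1 (h J hJ u fun s hs => ?_) χ hχ e' he'
    exact (h₁.holds_iff hJ u s).2 fun γ hγ => hu γ (Set.mem_biUnion hs hγ)
  refine (h₂.holds_iff hI v e).2 fun χ hχ => ?_
  refine h₂.sound hI v (h₂.entails_equivalence h₁ hχ) fun ξ hξ => ?_
  refine h₂.sound hI v (hentails ξ hξ) fun γ hγ => ?_
  obtain ⟨s, hs, hγ⟩ := Set.mem_iUnion₂.1 hγ
  exact h₂.sound hI v (h₁.entails_equivalence h₂ hγ) ((h₂.holds_iff hI v s).1 (hv s hs))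

end IsEquivalentSemanticsVia

/-- Each quasi-identity in `T₂` is itself an equational consequence over `models T₂`, so it
transfers. -/
theorem models_subset_models {T₁ T₂ : Set QuasiIdentity}
    (h : ∀ S e, EqConsequence (models.{w} T₂) S e → EqConsequence (models.{w} T₁) S e) :
    models.{w} T₁ ⊆ models.{w} T₂ := by
  intro I hI q hq v hv
  exact h {e | e ∈ q.premises} q.conclusion (fun J hJ u hu => hJ q hq u hu) I hI v hv

/-- Two quasivarieties that are equivalent semantics of the same consequence relation coincide. -/
theorem IsEquivalentSemantics.eq_of_isQuasivariety (hK₁ : IsQuasivariety K₁)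
    (hK₂ : IsQuasivariety K₂) (h₁ : IsEquivalentSemantics entails K₁)
    (h₂ : IsEquivalentSemantics entails K₂) : K₁ = K₂ := by
  obtain ⟨T₁, rfl⟩ := hK₁
  obtain ⟨T₂, rfl⟩ := hK₂
  obtain ⟨τ₁, D₁, h₁⟩ := h₁
  obtain ⟨τ₂, D₂, h₂⟩ := h₂
  exact (models_subset_models fun _ _ => h₂.eqConsequence_of h₁).antisymm
    (models_subset_models fun _ _ => h₁.eqConsequence_of h₂)

end Uniqueness

end LEA

/-- The class of algebras `(A, ⇨, 0)` axiomatized by the nine identities and quasi-identities is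
an equivalent algebraic semantics of the logic, it is the only quasivariety with this property, and
it is the class of lattice effect implication algebras. -/
theorem theorem4p3 :
    LEA.IsEquivalentSemanticsVia LEA.Derives (LEA.models.{u} LEA.laws)
      LEA.defining LEA.equivalence ∧
    (∀ K : Set LEA.ImpAlgebra.{u}, LEA.IsQuasivariety K →
      (LEA.IsEquivalentSemantics LEA.Derives K ↔ K = LEA.models.{u} LEA.laws)) ∧
    LEA.models.{u} LEA.laws = LEA.latticeEffectImplicationAlgebras.{u} := by
  exact ⟨LEA.isEquivalentSemanticsVia_models_laws,
    fun K hK => ⟨fun h => h.eq_of_isQuasivariety hK ⟨_, rfl⟩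
      ⟨_, _, LEA.isEquivalentSemanticsVia_models_laws⟩,
      fun h => h ▸ ⟨_, _, LEA.isEquivalentSemanticsVia_models_laws⟩⟩,
    LEA.models_laws_eq_latticeEffectImplicationAlgebras⟩
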